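/- Let $\mathcal E$ be an elementary topos with countable colimits, with chosen finite products, exponentials and subobject classifier $\Omega$. Consider its internal (Mitchell–Bénabou) language. The types are the objects of $\mathcal E$, where the product type is the chosen product and the type $PX$ is $\Omega^X$. The terms are built from variables, $\ast:\mathbb 1$, pairs, projections, applications $ft$ of morphisms $f$ of $\mathcal E$, and comprehensions $\{x:X\mid p\}:PX$. The formulas are built from $\top,\bot$, subobjects applied to terms, $t=s$, $t\in T$, $\wedge,\vee,\Rightarrow,\forall,\exists$ and countable disjunctions $\bigvee_{i}p_i$. In a context $\Delta=(x_1:A_1,\dots,x_n:A_n)$ with product $\overline\Delta=A_1\times\cdots\times A_n$, a term $t:X$ is interpreted in the usual way as a morphism $[\![\Delta.t]\!]:\overline\Delta\to X$, and a formula $p$ as a subobject $[\![\Delta.p]\!]\rightarrowtail\overline\Delta$; countable disjunctions are interpreted as countable joins of subobjects, and $\exists$ by images along projections. Let $A,B$ be objects of $\mathcal E$ and let $t_0,t_1$ be terms of type $B$ with no free variable other than $a:A$. Write $t_i(x)$ for $t_i[a:=x]$, and add indices of $t$ modulo $2$. Let $$R_{t_0,t_1}:=\Big\{z:B\times B\;\Big|\;\exists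 b_1,b_2:B,\ z=\langle b_1,b_2\rangle\wedge\Big(b_1=b_2\ \vee\ \bigvee_{n=1}^{\infty}\ \bigvee_{\alpha\in\mathbb Z_2^n}Z_\alpha(b_1,b_2)\Big)\Big\},$$ where, for $\alpha=(\alpha_1,\dots,\alpha_n)$, $$Z_\alpha(b_1,b_2):=\exists a_1,\dots,a_n:A,\ \big(b_1=t_{\alpha_1}(a_1)\big)\wedge\bigwedge_{i=1}^{n-1}\big(t_{\alpha_i+1}(a_i)=t_{\alpha_{i+1}}(a_{i+1})\big)\wedge\big(t_{\alpha_n+1}(a_n)=b_2\big).$$ For a variable $b:B$ let $[b]:=\{b':B\mid\langle b,b'\rangle\in R_{t_0,t_1}\}$, and let $\mathrm{Coeq}(t_0,t_1)(z)$ be the formula $\exists b:B,\ z=[b]$ with free variable $z:PB$. Then the morphism $[\![b:B.\,[b]]\!]:B\to\Omega^B$ factors through the subobject $[\![z:PB.\,\mathrm{Coeq}(t_0,t_1)(z)]\!]\rightarrowtail\Omega^B$ by a (necessarily unique) morphism $c:B\to[\![z:PB.\,\mathrm{Coeq}(t_0,t_1)(z)]\!]$, and the pair $\big([\![z:PB.\,\mathrm{Coeq}(t_0,t_1)(z)]\!],\,c\big)$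 is a coequaliser of $[\![a:A.\,t_0]\!],[\![a:A.\,t_1]\!]:A\to B$ in $\mathcal E$. -/

import Mathlib

open CategoryTheory CategoryTheory.Limits MonoidalCategory CartesianMonoidalCategory

universe u v

noncomputable section

namespace ToposLogic

/-! ### Operations on subobjects of a topos

A topos with countable colimits is a category `C` with finite limits, chosen finite products
(`CartesianMonoidalCategory C`), chosen exponentials (`MonoidalClosed C`), a subobject classifier
`cl : Subobject.Classifier C`, and countable colimits. -/

section Operations

variable {C : Type u} [Category.{v} C]

/-- The characteristic morphism of a subobject. -/
def chi (cl : Subobject.Classifier C) {X : C} (S : Subobject X) : X ⟶ cl.Ω := cl.χ S.arrow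

/-- The image of `f`: the equaliser of the cokernel pair of `f`. -/
def im [HasFiniteLimits C] [HasFiniteColimits C] {X Y : C} (f : X ⟶ Y) : Subobject Y :=
  equalizerSubobject (pushout.inl f f) (pushout.inr f f)

/-- The least subobject: the image of the map from the initial object. -/
def falsum [HasFiniteLimits C] [HasFiniteColimits C] (X : C) : Subobject X := im (initial.to X)

/-- Binary union: the image of the copairing of the two inclusions. -/
def union [HasFiniteLimits C] [HasFiniteColimits C] {X : C} (S T : Subobject X) : Subobject X :=
  im (coprod.desc S.arrow T.arrow)

/-- Countable union: the image of the map from the coproduct of all the subobjects. -/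
def iUnion [HasFiniteLimits C] [HasCountableColimits C] {X : C} (S : ℕ → Subobject X) :
    Subobject X :=
  im (Sigma.desc fun i => (S i).arrow)

/-- Heyting implication of subobjects (see `le_imp_iff`). -/
def imp [HasFiniteLimits C] (cl : Subobject.Classifier C) {X : C} (S T : Subobject X) :
    Subobject X :=
  equalizerSubobject (chi cl (S ⊓ T)) (chi cl S)

/-- The power object `Ω ^ X`. -/
abbrev Pow [CartesianMonoidalCategory C] [MonoidalClosed C] (cl : Subobject.Classifier C)
    (X : C) : C :=
  (ihom X).obj cl.Ω

/-- The transpose `Γ ⟶ Ω ^ X` of the characteristic morphism of a subobject of `X × Γ`. -/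
def transpose [CartesianMonoidalCategory C] [MonoidalClosed C] (cl : Subobject.Classifier C)
    {X Γ : C} (S : Subobject (X ⊗ Γ)) : Γ ⟶ Pow cl X :=
  MonoidalClosed.curry (chi cl S)

/-- The membership relation, the subobject of `X × Ω ^ X` classified by evaluation. -/
def membership [CartesianMonoidalCategory C] [MonoidalClosed C] [HasFiniteLimits C]
    (cl : Subobject.Classifier C) (X : C) : Subobject (X ⊗ Pow cl X) :=
  (Subobject.pullback ((ihom.ev X).app cl.Ω)).obj (Subobject.mk cl.truth)

/-- The right adjoint of pulling back along the projection `X × Γ ⟶ Γ` (see `le_univ_iff`): the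
part of `Γ` over which `S` is all of `X`. -/
def univ [CartesianMonoidalCategory C] [MonoidalClosed C] [HasFiniteLimits C]
    (cl : Subobject.Classifier C) {X Γ : C} (S : Subobject (X ⊗ Γ)) : Subobject Γ :=
  equalizerSubobject (transpose cl S) (transpose cl (⊤ : Subobject (X ⊗ Γ)))

end Operations

/-! These operations have the universal properties that define them in the poset of subobjects. -/

section OperationsLemmas

variable {C : Type u} [Category.{v} C]

theorem isPullback_chi (cl : Subobject.Classifier C) {X : C} (S : Subobject X) :
    IsPullback S.arrow (cl.χ₀ _) (chi cl S) cl.truth := cl.isPullback S.arrow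

/-- A morphism factors through `S` exactly when `S` is true along it. -/
theorem factors_iff_chi (cl : Subobject.Classifier C) {X Y : C} (S : Subobject X) (f : Y ⟶ X) :
    S.Factors f ↔ f ≫ chi cl S = cl.χ₀ Y ≫ cl.truth := by
  constructor
  · intro h
    rw [← S.factorThru_arrow f h, Category.assoc, (isPullback_chi cl S).w, ← Category.assoc]
    congr 1
    exact Subsingleton.elim _ _
  · intro h
    rw [← (isPullback_chi cl S).lift_fst _ _ h]
    exact Subobject.factors_comp_arrow _

theorem equalizerSubobject_factors [HasFiniteLimits C] {X Y Z : C} (f g : X ⟶ Y) (h : Z ⟶ X) :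
    (equalizerSubobject f g).Factors h ↔ h ≫ f = h ≫ g := by
  constructor
  · intro H
    obtain ⟨k, hk⟩ := (Subobject.mk_factors_iff _ _).1 H
    rw [← hk]
    exact (Category.assoc _ _ _).trans ((congrArg _ (equalizer.condition f g)).trans (Category.assoc _ _ _).symm)
  · intro H
    exact (Subobject.mk_factors_iff _ _).2 ⟨equalizer.lift h H, equalizer.lift_ι _ _⟩

theorem le_iff_factors {X : C} (S T : Subobject X) : S ≤ T ↔ T.Factors S.arrow :=
  ⟨fun h => Subobject.factors_of_le _ h S.factors_self, Subobject.le_of_factors⟩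

/-- `im f` is the least subobject through which `f` factors. -/
theorem im_le_iff [HasFiniteLimits C] [HasFiniteColimits C] (cl : Subobject.Classifier C) {X Y : C}
    (f : X ⟶ Y) (S : Subobject Y) : im f ≤ S ↔ S.Factors f := by
  constructor
  · intro h
    refine Subobject.factors_of_le _ h ?_
    exact (equalizerSubobject_factors _ _ _).2 pushout.condition
  · intro h
    rw [factors_iff_chi cl] at h
    have h' : f ≫ chi cl S = f ≫ cl.χ₀ Y ≫ cl.truth := by
      rw [h, ← Category.assoc]; congr 1; exact Subsingleton.elim _ _
    rw [le_iff_factors, factors_iff_chi cl]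
    have e := (equalizerSubobject_factors (pushout.inl f f) (pushout.inr f f)
      (im f).arrow).1 (Subobject.factors_self _)
    have e' := congrArg (· ≫ pushout.desc _ _ h') e
    simp only [Category.assoc, pushout.inl_desc, pushout.inr_desc] at e'
    rw [e', ← Category.assoc]; congr 1; exact Subsingleton.elim _ _

/-- `falsum` is the least subobject. -/
theorem falsum_le [HasFiniteLimits C] [HasFiniteColimits C] (cl : Subobject.Classifier C) {X : C}
    (S : Subobject X) : falsum X ≤ S :=
  (im_le_iff cl _ _).2 ((Subobject.factors_iff _ _).2 ⟨initial.to _, initial.hom_ext _ _⟩)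

/-- `union` is the binary join of subobjects. -/
theorem union_le_iff [HasFiniteLimits C] [HasFiniteColimits C] (cl : Subobject.Classifier C) {X : C}
    (S T U : Subobject X) : union S T ≤ U ↔ S ≤ U ∧ T ≤ U := by
  rw [union, im_le_iff cl, le_iff_factors, le_iff_factors]
  constructor
  · intro h
    exact ⟨coprod.inl_desc S.arrow T.arrow ▸ Subobject.factors_of_factors_right coprod.inl h,
      coprod.inr_desc S.arrow T.arrow ▸ Subobject.factors_of_factors_right coprod.inr h⟩
  · rintro ⟨h, k⟩
    have : coprod.desc S.arrow T.arrow = coprod.desc (U.factorThru _ h) (U.factorThru _ k) ≫ U.arrow := by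
      ext <;> simp
    rw [this]; exact Subobject.factors_comp_arrow _

/-- `iUnion` is the countable join (coproduct) of subobjects. -/
theorem iUnion_le_iff [HasFiniteLimits C] [HasCountableColimits C] (cl : Subobject.Classifier C)
    {X : C} (S : ℕ → Subobject X) (U : Subobject X) : iUnion S ≤ U ↔ ∀ i, S i ≤ U := by
  rw [iUnion, im_le_iff cl]
  simp only [le_iff_factors]
  constructor
  · intro h i
    simpa using Subobject.factors_of_factors_right (Sigma.ι (fun i => ((S i : C))) i) h
  · intro h
    have : (Sigma.desc fun i => (S i).arrow) = (Sigma.desc fun i => U.factorThru _ (h i)) ≫ U.arrow := by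
      ext i; simp
    rw [this]; exact Subobject.factors_comp_arrow _

theorem chi_ext (cl : Subobject.Classifier C) [HasFiniteLimits C] {X Y : C} (f : Y ⟶ X) (S T : Subobject X) :
    f ≫ chi cl S = f ≫ chi cl T ↔ (Subobject.pullback f).obj S = (Subobject.pullback f).obj T := by
  have key (U : Subobject X) : f ≫ chi cl U = chi cl ((Subobject.pullback f).obj U) :=
    cl.uniq _ ((Subobject.isPullback f U).flip.paste_vert (isPullback_chi cl U))
  rw [key, key]
  refine ⟨fun h => ?_, fun h => by rw [h]⟩
  refine le_antisymm ?_ ?_ <;> rw [le_iff_factors, factors_iff_chi cl]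
  · rw [← h, ← factors_iff_chi]; exact Subobject.factors_self _
  · rw [h, ← factors_iff_chi]; exact Subobject.factors_self _

/-- `imp` is the exponential in the poset of subobjects. -/
theorem le_imp_iff [HasFiniteLimits C] (cl : Subobject.Classifier C) {X : C} (S T U : Subobject X) :
    U ≤ imp cl S T ↔ U ⊓ S ≤ T := by
  rw [imp, le_iff_factors, equalizerSubobject_factors, chi_ext, le_iff_factors]
  constructor
  · intro h
    have h1 : ((Subobject.pullback U.arrow).obj S).Factors (Subobject.ofLE (U ⊓ S) U inf_le_left) := by
      rw [Limits.pullback_factors_iff, Subobject.ofLE_arrow, ← le_iff_factors]; exact inf_le_right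
    rw [← h, Limits.pullback_factors_iff, Subobject.ofLE_arrow, ← le_iff_factors] at h1
    rw [← le_iff_factors]; exact h1.trans inf_le_right
  · intro h
    refine le_antisymm ((Subobject.pullback _).monotone inf_le_left) ?_
    rw [← le_iff_factors] at h
    rw [Subobject.inf_pullback]
    refine le_inf le_rfl ?_
    rw [le_iff_factors, Limits.pullback_factors_iff]
    refine Subobject.factors_of_le _ h ((Subobject.inf_factors _).2
      ⟨Subobject.factors_comp_arrow _, ?_⟩)
    rw [← Limits.pullback_factors_iff]; exact Subobject.factors_self _

/-- `univ` is right adjoint to pulling back along the projection. -/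
theorem le_univ_iff [CartesianMonoidalCategory C] [MonoidalClosed C] [HasFiniteLimits C]
    (cl : Subobject.Classifier C) {X Γ : C} (S : Subobject (X ⊗ Γ)) (T : Subobject Γ) :
    T ≤ univ cl S ↔ (Subobject.pullback (snd X Γ)).obj T ≤ S := by
  rw [univ, le_iff_factors, equalizerSubobject_factors, transpose, transpose,
    ← MonoidalClosed.curry_natural_left, ← MonoidalClosed.curry_natural_left]
  rw [(MonoidalClosed.curry_injective).eq_iff, chi_ext,
    Subobject.pullback_top]
  constructor
  · intro h
    rw [le_iff_factors]
    have hT := (Limits.pullback_factors_iff _ _ _).1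
      (Subobject.factors_self ((Subobject.pullback (snd X Γ)).obj T))
    have e : ((Subobject.pullback (snd X Γ)).obj T).arrow =
        lift (((Subobject.pullback (snd X Γ)).obj T).arrow ≫ fst X Γ) (T.factorThru _ hT) ≫
          X ◁ T.arrow := by
      ext <;> simp
    rw [e, ← Limits.pullback_factors_iff, h]
    exact Subobject.top_factors _
  · intro h
    refine le_antisymm le_top ?_
    rw [le_iff_factors, Limits.pullback_factors_iff]
    refine Subobject.factors_of_factors_right _ (Subobject.factors_of_le _ h ?_)
    rw [Limits.pullback_factors_iff, whiskerLeft_snd]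
    exact Subobject.factors_comp_arrow _

end OperationsLemmas

/-! ### The language

Types are the objects of `C`, the product type is the chosen product, and the type `P X` is the
chosen exponential `Ω ^ X`. Terms and formulas up to renaming of bound variables are represented
as well-typed, well-scoped de Bruijn terms: a context is the list of the types of its variables,
the most recently introduced variable first. -/

section Language

variable {C : Type u} [Category.{v} C]

/-- The variables of type `X` in a context. -/
inductive Var : List C → C → Type u
  | zero {Γ : List C} {X : C} : Var (X :: Γ) X
  | succ {Γ : List C} {X Y : C} (x : Var Γ X) : Var (Y :: Γ) X

variable [CartesianMonoidalCategory C] [MonoidalClosed C]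

mutual

/-- Terms `t : X` in a context. -/
inductive Tm (cl : Subobject.Classifier C) : List C → C → Type (max u v)
  | var {Γ : List C} {X : C} (x : Var Γ X) : Tm cl Γ X
  | star {Γ : List C} : Tm cl Γ (𝟙_ C)
  | pair {Γ : List C} {X Y : C} (t : Tm cl Γ X) (s : Tm cl Γ Y) : Tm cl Γ (X ⊗ Y)
  | proj₁ {Γ : List C} {X Y : C} (t : Tm cl Γ (X ⊗ Y)) : Tm cl Γ X
  | proj₂ {Γ : List C} {X Y : C} (t : Tm cl Γ (X ⊗ Y)) : Tm cl Γ Y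
  /-- A function symbol, that is a morphism of `C`, applied to a term. -/
  | app {Γ : List C} {X Y : C} (f : X ⟶ Y) (t : Tm cl Γ X) : Tm cl Γ Y
  /-- The comprehension term `{x : X | p}`. -/
  | compr {Γ : List C} {X : C} (p : Fm cl (X :: Γ)) : Tm cl Γ (Pow cl X)

/-- Formulas in a context. -/
inductive Fm (cl : Subobject.Classifier C) : List C → Type (max u v)
  | top {Γ : List C} : Fm cl Γ
  | bot {Γ : List C} : Fm cl Γ
  /-- A relation symbol, that is a subobject in `C`, applied to a term. -/
  | rel {Γ : List C} {X : C} (r : Subobject X) (t : Tm cl Γ X) : Fm cl Γ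
  | eq {Γ : List C} {X : C} (t s : Tm cl Γ X) : Fm cl Γ
  | and {Γ : List C} (p q : Fm cl Γ) : Fm cl Γ
  | or {Γ : List C} (p q : Fm cl Γ) : Fm cl Γ
  | imp {Γ : List C} (p q : Fm cl Γ) : Fm cl Γ
  /-- The countable disjunction. -/
  | iOr {Γ : List C} (p : ℕ → Fm cl Γ) : Fm cl Γ
  | all {Γ : List C} {X : C} (p : Fm cl (X :: Γ)) : Fm cl Γ
  | ex {Γ : List C} {X : C} (p : Fm cl (X :: Γ)) : Fm cl Γ
  | mem {Γ : List C} {X : C} (t : Tm cl Γ X) (T : Tm cl Γ (Pow cl X)) : Fm cl Γ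

end

/-- The extension of a renaming of variables under a binder. -/
def Var.lift {Γ Δ : List C} (ρ : ∀ X : C, Var Γ X → Var Δ X) (Y : C) :
    ∀ X : C, Var (Y :: Γ) X → Var (Y :: Δ) X
  | _, .zero => .zero
  | _, .succ x => .succ (ρ _ x)

variable {cl : Subobject.Classifier C}

mutual

/-- Simultaneous (capture-avoiding) substitution of variables for variables in a term. -/
def Tm.rename : {Γ : List C} → {X : C} → Tm cl Γ X → {Δ : List C} →
    (∀ X : C, Var Γ X → Var Δ X) → Tm cl Δ X
  | _, _, .var x, _, ρ => .var (ρ _ x)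
  | _, _, .star, _, _ => .star
  | _, _, .pair t s, _, ρ => .pair (t.rename ρ) (s.rename ρ)
  | _, _, .proj₁ t, _, ρ => .proj₁ (t.rename ρ)
  | _, _, .proj₂ t, _, ρ => .proj₂ (t.rename ρ)
  | _, _, .app f t, _, ρ => .app f (t.rename ρ)
  | _, _, .compr p, _, ρ => .compr (p.rename (Var.lift ρ _))

/-- Simultaneous (capture-avoiding) substitution of variables for variables in a formula. -/
def Fm.rename : {Γ : List C} → Fm cl Γ → {Δ : List C} →
    (∀ X : C, Var Γ X → Var Δ X) → Fm cl Δ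
  | _, .top, _, _ => .top
  | _, .bot, _, _ => .bot
  | _, .rel r t, _, ρ => .rel r (t.rename ρ)
  | _, .eq t s, _, ρ => .eq (t.rename ρ) (s.rename ρ)
  | _, .and p q, _, ρ => .and (p.rename ρ) (q.rename ρ)
  | _, .or p q, _, ρ => .or (p.rename ρ) (q.rename ρ)
  | _, .imp p q, _, ρ => .imp (p.rename ρ) (q.rename ρ)
  | _, .iOr p, _, ρ => .iOr fun i => (p i).rename ρ
  | _, .all p, _, ρ => .all (p.rename (Var.lift ρ _))
  | _, .ex p, _, ρ => .ex (p.rename (Var.lift ρ _))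
  | _, .mem t T, _, ρ => .mem (t.rename ρ) (T.rename ρ)

end

end Language

/-! ### The interpretation -/

section Interpretation

variable {C : Type u} [Category.{v} C] [CartesianMonoidalCategory C]

/-- The object interpreting a context: the product of the types of its variables (the terminal
object for the empty context, the type itself for a context with one variable). -/
def ctx : List C → C
  | [] => 𝟙_ C
  | [X] => X
  | X :: Y :: Γ => X ⊗ ctx (Y :: Γ)

/-- The canonical isomorphism `X × ⟦Γ⟧ ⟶ ⟦Γ, X⟧`. -/
def ctxExt : (Γ : List C) → (X : C) → (X ⊗ ctx Γ ≅ ctx (X :: Γ))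
  | [], X => ρ_ X
  | _ :: _, _ => Iso.refl _

/-- The projection `⟦Γ, X⟧ ⟶ ⟦Γ⟧` that forgets the newest variable. -/
def ctxDrop (Γ : List C) (X : C) : ctx (X :: Γ) ⟶ ctx Γ := (ctxExt Γ X).inv ≫ snd X (ctx Γ)

/-- The projection `⟦Γ, X⟧ ⟶ X` to the newest variable. -/
def ctxLast : (Γ : List C) → (X : C) → (ctx (X :: Γ) ⟶ X)
  | [], X => 𝟙 X
  | Y :: Γ, X => fst X (ctx (Y :: Γ))

/-- A variable is interpreted as a projection. -/
def Var.interp : {Γ : List C} → {X : C} → Var Γ X → (ctx Γ ⟶ X)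
  | _, _, .zero => ctxLast _ _
  | _, _, .succ x => ctxDrop _ _ ≫ x.interp

variable [MonoidalClosed C] [HasFiniteLimits C] [HasCountableColimits C]
  {cl : Subobject.Classifier C}

mutual

/-- The morphism `⟦Γ. t⟧`, lifted to the universe in which the subobjects `⟦Γ. p⟧` live. -/
def Tm.interpAux : {Γ : List C} → {X : C} → Tm cl Γ X → ULift.{u, v} (ctx Γ ⟶ X)
  | _, _, .var x => ⟨x.interp⟩
  | _, _, .star => ⟨toUnit _⟩
  | _, _, .pair t s => ⟨lift t.interpAux.down s.interpAux.down⟩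
  | _, _, .proj₁ t => ⟨t.interpAux.down ≫ fst _ _⟩
  | _, _, .proj₂ t => ⟨t.interpAux.down ≫ snd _ _⟩
  | _, _, .app f t => ⟨t.interpAux.down ≫ f⟩
  | Γ, _, .compr (X := X) p =>
      ⟨transpose cl ((Subobject.pullback (ctxExt Γ X).hom).obj p.interp)⟩

/-- The interpretation `⟦Γ. p⟧` of a formula: a subobject. -/
def Fm.interp : {Γ : List C} → Fm cl Γ → Subobject (ctx Γ)
  | _, .top => ⊤
  | _, .bot => falsum _
  | _, .rel r t => (Subobject.pullback t.interpAux.down).obj r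
  | _, .eq t s => equalizerSubobject t.interpAux.down s.interpAux.down
  | _, .and p q => p.interp ⊓ q.interp
  | _, .or p q => union p.interp q.interp
  | _, .imp p q => ToposLogic.imp cl p.interp q.interp
  | _, .iOr p => iUnion fun i => (p i).interp
  | Γ, .all (X := X) p => univ cl ((Subobject.pullback (ctxExt Γ X).hom).obj p.interp)
  | Γ, .ex (X := X) p => im (p.interp.arrow ≫ ctxDrop Γ X)
  | _, .mem (X := X) t T =>
      (Subobject.pullback (lift t.interpAux.down T.interpAux.down)).obj (membership cl X)

end

/-- The interpretation `⟦Γ. t⟧` of a term: a morphism. -/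
def Tm.interp {Γ : List C} {X : C} (t : Tm cl Γ X) : ctx Γ ⟶ X := t.interpAux.down

end Interpretation

/-! ### The relation generated by two terms, its classes, and the formula `Coeq` -/

section Coeq

variable {C : Type u} [Category.{v} C] [CartesianMonoidalCategory C] [MonoidalClosed C]
  {cl : Subobject.Classifier C}

/-- A finite conjunction. -/
def finAnd {Γ : List C} : (n : ℕ) → (Fin n → Fm cl Γ) → Fm cl Γ
  | 0, _ => .top
  | n + 1, p => .and (finAnd n fun i => p i.castSucc) (p (Fin.last n))

/-- A finite disjunction. -/
def finOr {Γ : List C} : (n : ℕ) → (Fin n → Fm cl Γ) → Fm cl Γ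
  | 0, _ => .bot
  | n + 1, p => .or (finOr n fun i => p i.castSucc) (p (Fin.last n))

/-- The context `Γ, a₁ : A, …, aₙ : A`. -/
def ctxAppend (Γ : List C) (A : C) : ℕ → List C
  | 0 => Γ
  | n + 1 => A :: ctxAppend Γ A n

/-- The `i`-th of the variables `a₁, …, aₙ` of the context `Γ, a₁ : A, …, aₙ : A`. -/
def newVar (Γ : List C) (A : C) : (n : ℕ) → Fin n → Var (ctxAppend Γ A n) A
  | 0, i => i.elim0
  | n + 1, i => Fin.lastCases (motive := fun _ => Var (ctxAppend Γ A (n + 1)) A)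
      .zero (fun j => .succ (newVar Γ A n j)) i

/-- A variable of `Γ` as a variable of `Γ, a₁ : A, …, aₙ : A`. -/
def oldVar {Γ : List C} (A : C) {X : C} (x : Var Γ X) : (n : ℕ) → Var (ctxAppend Γ A n) X
  | 0 => x
  | n + 1 => .succ (oldVar A x n)

/-- The formula `∃ a₁ … aₙ : A, p`. -/
def exMany {Γ : List C} (A : C) : (n : ℕ) → Fm cl (ctxAppend Γ A n) → Fm cl Γ
  | 0, p => p
  | n + 1, p => exMany A n (.ex p)

/-- The term `t[a := x]` in a context `Γ`, for a term `t` with the only free variable `a : A` and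
a variable `x : A` of `Γ`. -/
def Tm.at {A B : C} (t : Tm cl [A] B) {Γ : List C} (x : Var Γ A) : Tm cl Γ B :=
  t.rename fun _ y => match y with
    | .zero => x

/-- For `α : ℤ₂ⁿ⁺¹`, the formula
`∃ a₀ … aₙ : A, b₁ = t_{α₀}(a₀) ∧ (⋀_{i < n} t_{αᵢ + 1}(aᵢ) = t_{αᵢ₊₁}(aᵢ₊₁)) ∧ t_{αₙ + 1}(aₙ) = b₂`,
which says that a zig-zag of length `n + 1` of type `α` connects `b₁` and `b₂`. -/
def zigzag {A B : C} (t : Fin 2 → Tm cl [A] B) {Γ : List C} (b₁ b₂ : Var Γ B) (n : ℕ)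
    (α : Fin (n + 1) → Fin 2) : Fm cl Γ :=
  exMany A (n + 1) (.and (.and
    (.eq (.var (oldVar A b₁ (n + 1))) ((t (α 0)).at (newVar Γ A (n + 1) 0)))
    (finAnd n fun i =>
      .eq ((t (α i.castSucc + 1)).at (newVar Γ A (n + 1) i.castSucc))
        ((t (α i.succ)).at (newVar Γ A (n + 1) i.succ))))
    (.eq ((t (α (Fin.last n) + 1)).at (newVar Γ A (n + 1) (Fin.last n)))
      (.var (oldVar A b₂ (n + 1)))))

/-- The formula `b₁ = b₂ ∨ ⋁_{n ≥ 1} ⋁_{α ∈ ℤ₂ⁿ} (a zig-zag of type α connects b₁ and b₂)`. -/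
def connected {A B : C} (t₀ t₁ : Tm cl [A] B) {Γ : List C} (b₁ b₂ : Var Γ B) : Fm cl Γ :=
  .or (.eq (.var b₁) (.var b₂))
    (.iOr fun n => finOr (2 ^ (n + 1)) fun k => zigzag ![t₀, t₁] b₁ b₂ n
      (finFunctionFinEquiv.symm k))

/-- The closed term
`R = {z : B × B | ∃ b₁ b₂ : B, z = ⟨b₁, b₂⟩ ∧ (b₁ and b₂ are equal or connected by a zig-zag)}`,
in an arbitrary context. -/
def relTm {A B : C} (t₀ t₁ : Tm cl [A] B) (Γ : List C) : Tm cl Γ (Pow cl (B ⊗ B)) :=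
  .compr (.ex (X := B) (.ex (X := B) (.and
    (.eq (.var (.succ (.succ .zero))) (.pair (.var (.succ .zero)) (.var .zero)))
    (connected t₀ t₁ (.succ .zero) .zero))))

/-- The term `[b] = {b' : B | ⟨b, b'⟩ ∈ R}`, for a variable `b : B`. -/
def classTm {A B : C} (t₀ t₁ : Tm cl [A] B) {Γ : List C} (b : Var Γ B) : Tm cl Γ (Pow cl B) :=
  .compr (.mem (.pair (.var (.succ b)) (.var .zero)) (relTm t₀ t₁ (B :: Γ)))

/-- The formula `Coeq(t₀, t₁)(z) := ∃ b : B, z = [b]` in the context `z : P B`. -/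
def coeqFm {A B : C} (t₀ t₁ : Tm cl [A] B) : Fm cl [Pow cl B] :=
  .ex (X := B) (.eq (.var (.succ .zero)) (classTm t₀ t₁ .zero))

end Coeq

end ToposLogic

end

namespace ToposLogic

section Forcing

variable {C : Type u} [Category.{v} C]

theorem le_iff_forall_factors {X : C} (S T : Subobject X) :
    S ≤ T ↔ ∀ (Y : C) (f : Y ⟶ X), S.Factors f → T.Factors f :=
  ⟨fun h _ _ hf => Subobject.factors_of_le _ h hf,
    fun h => (le_iff_factors S T).2 (h _ _ S.factors_self)⟩

theorem ext_factors {X : C} {S T : Subobject X}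
    (h : ∀ (Y : C) (f : Y ⟶ X), S.Factors f ↔ T.Factors f) : S = T :=
  le_antisymm ((le_iff_forall_factors _ _).2 fun Y f => (h Y f).1)
    ((le_iff_forall_factors _ _).2 fun Y f => (h Y f).2)

theorem mk_factors_iff_exists {X Y Z : C} (f : X ⟶ Y) [Mono f] (g : Z ⟶ Y) :
    (Subobject.mk f).Factors g ↔ ∃ k : Z ⟶ X, k ≫ f = g :=
  Subobject.mk_factors_iff f g

/-- Whether a morphism factors through a subobject can be tested on an epimorphic cover. -/
theorem factors_of_epi (cl : Subobject.Classifier C) {X Y Z : C} (S : Subobject X) (e : Z ⟶ Y)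
    [Epi e] {f : Y ⟶ X} (h : S.Factors (e ≫ f)) : S.Factors f := by
  rw [factors_iff_chi cl] at h ⊢
  rw [← cancel_epi e, ← Category.assoc, h, ← Category.assoc]
  congr 1
  exact Subsingleton.elim _ _

theorem isIso_of_mono_of_epi (cl : Subobject.Classifier C) {X Y : C} (f : X ⟶ Y) [Mono f] [Epi f] :
    IsIso f := by
  have h : (Subobject.mk f).Factors (𝟙 Y) := by
    refine factors_of_epi cl _ f ?_
    exact (mk_factors_iff_exists _ _).2 ⟨𝟙 X, by simp⟩
  obtain ⟨k, hk⟩ := (mk_factors_iff_exists _ _).1 h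
  exact ⟨k, by rw [← cancel_mono f, Category.assoc, hk]; simp, hk⟩

variable [HasFiniteLimits C]

theorem imp_factors_iff (cl : Subobject.Classifier C) {X Y : C} (S T : Subobject X) (f : Y ⟶ X) :
    (imp cl S T).Factors f ↔
      ∀ (Z : C) (g : Z ⟶ Y), S.Factors (g ≫ f) → T.Factors (g ≫ f) := by
  constructor
  · intro h Z g hg
    exact Subobject.factors_of_le _ ((le_imp_iff cl S T _).1 le_rfl)
      ((Subobject.inf_factors _).2 ⟨Subobject.factors_of_factors_right _ h, hg⟩)
  · intro h
    rw [imp, equalizerSubobject_factors, chi_ext]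
    refine ext_factors fun Z g => ?_
    rw [Limits.pullback_factors_iff, Limits.pullback_factors_iff, Subobject.inf_factors]
    exact ⟨fun k => k.1, fun k => ⟨k, h Z g k⟩⟩

/-- In a topos, epimorphisms are stable under pullback. -/
theorem epi_of_isPullback [CartesianMonoidalCategory C] [MonoidalClosed C]
    (cl : Subobject.Classifier C) {P X Y Z : C} {p : P ⟶ X} {q : P ⟶ Y} {g : X ⟶ Z} {f : Y ⟶ Z}
    (sq : IsPullback p q g f) [Epi f] : Epi p where
  left_cancellation {W} u v huv := by
    let M : Subobject (X ⊗ Z) := equalizerSubobject (fst X Z ≫ g) (snd X Z)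
    let T : Subobject (X ⊗ Z) := equalizerSubobject (fst X Z ≫ u) (fst X Z ≫ v)
    have : Epi (X ◁ f) := inferInstanceAs (Epi ((tensorLeft X).map f))
    have key : (imp cl M T).Factors (𝟙 (X ⊗ Z)) := by
      refine factors_of_epi cl _ (X ◁ f) ?_
      rw [imp_factors_iff]
      intro V x hx
      rw [equalizerSubobject_factors] at hx ⊢
      simp only [Category.assoc, Category.comp_id, whiskerLeft_fst_assoc, whiskerLeft_snd] at hx ⊢
      obtain ⟨l, e⟩ : ∃ l : V ⟶ P, l ≫ p = x ≫ fst X Y :=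
        ⟨_, sq.lift_fst (x ≫ fst X Y) (x ≫ snd X Y) (by simpa using hx)⟩
      rw [← Category.assoc, ← Category.assoc, ← e, Category.assoc, Category.assoc, huv]
    have := (imp_factors_iff cl M T _).1 key X (lift (𝟙 X) g)
      ((equalizerSubobject_factors _ _ _).2 (by simp))
    simpa using (equalizerSubobject_factors _ _ _).1 this

theorem im_factors_self [HasFiniteColimits C] {X Y : C} (f : X ⟶ Y) : (im f).Factors f :=
  (equalizerSubobject_factors _ _ _).2 pushout.condition

theorem epi_factorThru_im [HasFiniteColimits C] (cl : Subobject.Classifier C) {X Y : C}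
    (f : X ⟶ Y) : Epi ((im f).factorThru f (im_factors_self f)) where
  left_cancellation {W} u v huv := by
    have h : im f ≤ Subobject.mk (equalizer.ι u v ≫ (im f).arrow) := by
      rw [im_le_iff cl]
      exact (mk_factors_iff_exists _ _).2 ⟨equalizer.lift _ huv, by simp⟩
    obtain ⟨k, hk⟩ := (mk_factors_iff_exists _ _).1 ((le_iff_factors _ _).1 h)
    have hk' : k ≫ equalizer.ι u v = 𝟙 _ := by
      rw [← cancel_mono (im f).arrow, Category.assoc, Category.id_comp]; exact hk
    rw [← Category.id_comp u, ← Category.id_comp v, ← hk', Category.assoc, Category.assoc,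
      equalizer.condition]

/-- A morphism factors through the image of `f` exactly when it locally lifts along `f`. -/
theorem im_factors_iff [HasFiniteColimits C] [CartesianMonoidalCategory C] [MonoidalClosed C]
    (cl : Subobject.Classifier C) {X Y Z : C} (f : X ⟶ Y) (g : Z ⟶ Y) :
    (im f).Factors g ↔ ∃ (W : C) (e : W ⟶ Z) (y : W ⟶ X), Epi e ∧ y ≫ f = e ≫ g := by
  constructor
  · intro h
    have := epi_factorThru_im cl f
    refine ⟨_, _, pullback.snd _ _, epi_of_isPullback cl (IsPullback.of_hasPullback ((im f).factorThru g h)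
      ((im f).factorThru f (im_factors_self f))), ?_⟩
    have := congrArg (· ≫ (im f).arrow) (pullback.condition (f := (im f).factorThru g h)
      (g := (im f).factorThru f (im_factors_self f)))
    simpa using this.symm
  · rintro ⟨W, e, y, he, h⟩
    refine factors_of_epi cl _ e ?_
    rw [← h]
    exact Subobject.factors_of_factors_right _ (im_factors_self f)

/-- A morphism that coequalises everything the epimorphism `c` coequalises factors through `c`. -/
theorem exists_desc_of_epi [HasFiniteColimits C] [CartesianMonoidalCategory C] [MonoidalClosed C]
    (cl : Subobject.Classifier C) {B Q Z : C} (c : B ⟶ Q) [Epi c] (h : B ⟶ Z)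
    (H : ∀ (X : C) (f g : X ⟶ B), f ≫ c = g ≫ c → f ≫ h = g ≫ h) : ∃ d : Q ⟶ Z, c ≫ d = h := by
  let I := im (lift c h)
  let q := I.factorThru _ (im_factors_self (lift c h))
  have hq : q ≫ I.arrow = lift c h := Subobject.factorThru_arrow _ _ _
  have hqc : q ≫ I.arrow ≫ fst Q Z = c := by rw [← Category.assoc, hq, lift_fst]
  have : Epi (I.arrow ≫ fst Q Z) := by
    have : Epi (q ≫ I.arrow ≫ fst Q Z) := by rw [hqc]; infer_instance
    exact epi_of_epi q _
  have : Mono (I.arrow ≫ fst Q Z) := by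
    constructor
    intro X x y hxy
    obtain ⟨W, e, x', he, hx⟩ :=
      (im_factors_iff cl (lift c h) _).1 (Subobject.factors_comp_arrow (P := I) x)
    obtain ⟨W', e', y', he', hy⟩ :=
      (im_factors_iff cl (lift c h) _).1 (Subobject.factors_comp_arrow (P := I) (e ≫ y))
    have hx' : (e' ≫ x') ≫ lift c h = (e' ≫ e) ≫ x ≫ I.arrow := by simp only [Category.assoc, hx]
    have hy' : y' ≫ lift c h = (e' ≫ e) ≫ y ≫ I.arrow := by simp only [Category.assoc, hy]
    have h1 : (e' ≫ x') ≫ c = y' ≫ c := by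
      have a := congrArg (· ≫ fst Q Z) hx'
      have b := congrArg (· ≫ fst Q Z) hy'
      simp only [Category.assoc, lift_fst] at a b hxy ⊢
      rw [a, b, hxy]
    have h2 := H _ _ _ h1
    have h3 : (e' ≫ x') ≫ lift c h = y' ≫ lift c h := by
      rw [comp_lift, comp_lift, h1, h2]
    rw [hx', hy'] at h3
    simpa only [cancel_epi, cancel_mono] using h3
  have := isIso_of_mono_of_epi cl (I.arrow ≫ fst Q Z)
  refine ⟨inv (I.arrow ≫ fst Q Z) ≫ I.arrow ≫ snd Q Z, ?_⟩
  rw [← hqc, Category.assoc, IsIso.hom_inv_id_assoc, ← Category.assoc, hq, lift_snd]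

/-- Pulling back along `f` has a right adjoint on subobjects. -/
theorem exists_forall_along [CartesianMonoidalCategory C] [MonoidalClosed C]
    (cl : Subobject.Classifier C) {X Y : C} (f : X ⟶ Y) (T : Subobject X) :
    ∃ U : Subobject Y, ∀ S : Subobject Y, S ≤ U ↔ (Subobject.pullback f).obj S ≤ T := by
  refine ⟨univ cl (imp cl (equalizerSubobject (fst X Y ≫ f) (snd X Y))
    ((Subobject.pullback (fst X Y)).obj T)), fun S => ?_⟩
  rw [le_univ_iff, le_imp_iff, le_iff_forall_factors, le_iff_forall_factors]
  simp only [Subobject.inf_factors, Limits.pullback_factors_iff, equalizerSubobject_factors]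
  constructor
  · intro h Z x hx
    simpa using h Z (lift x (x ≫ f)) (by simpa using hx)
  · rintro h Z x ⟨hx, e⟩
    refine h Z _ ?_
    rwa [Category.assoc, e]

theorem pullback_equalizerSubobject {X Y Z : C} (r : Z ⟶ X) (f g : X ⟶ Y) :
    (Subobject.pullback r).obj (equalizerSubobject f g) =
      equalizerSubobject (r ≫ f) (r ≫ g) := by
  refine ext_factors fun W x => ?_
  simp only [Limits.pullback_factors_iff, equalizerSubobject_factors, Category.assoc]

section Joins

variable [CartesianMonoidalCategory C] [MonoidalClosed C]

theorem pullback_falsum (cl : Subobject.Classifier C) [HasFiniteColimits C] {X Y : C} (f : X ⟶ Y) :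
    (Subobject.pullback f).obj (falsum Y) = falsum X := by
  refine le_antisymm ?_ (falsum_le cl _)
  obtain ⟨U, hU⟩ := exists_forall_along cl f (falsum X)
  exact (hU _).1 (falsum_le cl _)

theorem pullback_union (cl : Subobject.Classifier C) [HasFiniteColimits C] {X Y : C}
    (f : X ⟶ Y) (S T : Subobject Y) :
    (Subobject.pullback f).obj (union S T) =
      union ((Subobject.pullback f).obj S) ((Subobject.pullback f).obj T) := by
  have h := (union_le_iff cl S T _).1 le_rfl
  have h' := (union_le_iff cl ((Subobject.pullback f).obj S) ((Subobject.pullback f).obj T) _).1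
    le_rfl
  refine le_antisymm ?_ ((union_le_iff cl _ _ _).2
    ⟨(Subobject.pullback f).monotone h.1, (Subobject.pullback f).monotone h.2⟩)
  obtain ⟨U, hU⟩ := exists_forall_along cl f (union ((Subobject.pullback f).obj S)
    ((Subobject.pullback f).obj T))
  rw [← hU, union_le_iff cl, hU, hU]
  exact h'

theorem pullback_iUnion (cl : Subobject.Classifier C) [HasCountableColimits C] {X Y : C}
    (f : X ⟶ Y) (S : ℕ → Subobject Y) :
    (Subobject.pullback f).obj (iUnion S) = iUnion fun i => (Subobject.pullback f).obj (S i) := by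
  refine le_antisymm ?_ ((iUnion_le_iff cl _ _).2 fun i =>
    (Subobject.pullback f).monotone ((iUnion_le_iff cl S _).1 le_rfl i))
  obtain ⟨U, hU⟩ := exists_forall_along cl f (iUnion fun i => (Subobject.pullback f).obj (S i))
  rw [← hU, iUnion_le_iff cl]
  intro i
  rw [hU]
  exact (iUnion_le_iff cl (fun i => (Subobject.pullback f).obj (S i)) _).1 le_rfl i

end Joins

theorem pullback_imp (cl : Subobject.Classifier C) {X Y : C} (f : X ⟶ Y) (S T : Subobject Y) :
    (Subobject.pullback f).obj (imp cl S T) =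
      imp cl ((Subobject.pullback f).obj S) ((Subobject.pullback f).obj T) := by
  refine ext_factors fun Z g => ?_
  simp only [imp_factors_iff, Limits.pullback_factors_iff, Category.assoc]

theorem chi_pullback (cl : Subobject.Classifier C) {X Y : C} (f : X ⟶ Y) (S : Subobject Y) :
    chi cl ((Subobject.pullback f).obj S) = f ≫ chi cl S :=
  (cl.uniq _ ((Subobject.isPullback f S).flip.paste_vert (isPullback_chi cl S))).symm

theorem chi_injective (cl : Subobject.Classifier C) {X : C} {S T : Subobject X}
    (h : chi cl S = chi cl T) : S = T := by
  have := (chi_ext cl (𝟙 X) S T).1 (by rw [h])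
  simpa [Subobject.pullback_id] using this

section Power

variable [CartesianMonoidalCategory C] [MonoidalClosed C] (cl : Subobject.Classifier C)

theorem transpose_pullback {X Γ Δ : C} (r : Δ ⟶ Γ) (S : Subobject (X ⊗ Γ)) :
    transpose cl ((Subobject.pullback (X ◁ r)).obj S) = r ≫ transpose cl S := by
  rw [transpose, transpose, chi_pullback, MonoidalClosed.curry_natural_left]

theorem transpose_injective {X Γ : C} {S T : Subobject (X ⊗ Γ)}
    (h : transpose cl S = transpose cl T) : S = T :=
  chi_injective cl (MonoidalClosed.curry_injective h)

theorem pullback_univ {X Γ Δ : C} (r : Δ ⟶ Γ) (S : Subobject (X ⊗ Γ)) :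
    (Subobject.pullback r).obj (univ cl S) =
      univ cl ((Subobject.pullback (X ◁ r)).obj S) := by
  refine ext_factors fun Z g => ?_
  have e : (⊤ : Subobject (X ⊗ Δ)) = (Subobject.pullback (X ◁ r)).obj ⊤ :=
    (Subobject.pullback_top _).symm
  rw [Limits.pullback_factors_iff, univ, univ, equalizerSubobject_factors,
    equalizerSubobject_factors, e, transpose_pullback, transpose_pullback]
  simp only [Category.assoc]

/-- The comprehension axiom. -/
theorem membership_factors_iff {X Γ : C} (x : Γ ⟶ X) (S : Subobject (X ⊗ Γ)) :
    (membership cl X).Factors (lift x (transpose cl S)) ↔ S.Factors (lift x (𝟙 Γ)) := by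
  have e : lift x (transpose cl S) = lift x (𝟙 Γ) ≫ X ◁ transpose cl S := by simp
  have e' : X ◁ transpose cl S ≫ (ihom.ev X).app cl.Ω = chi cl S :=
    MonoidalClosed.uncurry_eq (transpose cl S) ▸ MonoidalClosed.uncurry_curry _
  rw [membership, Limits.pullback_factors_iff, e, Category.assoc, e', factors_iff_chi cl S,
    mk_factors_iff_exists]
  constructor
  · rintro ⟨k, hk⟩
    rw [← hk]
    congr 1
    exact Subsingleton.elim _ _
  · intro h
    exact ⟨_, h.symm⟩

end Power

end Forcing

section Variables

variable {C : Type u}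

theorem newVar_last (Γ : List C) (A : C) (n : ℕ) :
    newVar Γ A (n + 1) (Fin.last n) = Var.zero :=
  Fin.lastCases_last (motive := fun _ => Var (ctxAppend Γ A (n + 1)) A)

theorem newVar_castSucc (Γ : List C) (A : C) (n : ℕ) (i : Fin n) :
    newVar Γ A (n + 1) i.castSucc = Var.succ (newVar Γ A n i) :=
  Fin.lastCases_castSucc (motive := fun _ => Var (ctxAppend Γ A (n + 1)) A) i

end Variables

section Contexts

variable {C : Type u} [Category.{v} C] [CartesianMonoidalCategory C]

theorem ctxExt_hom_drop (Γ : List C) (X : C) :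
    (ctxExt Γ X).hom ≫ ctxDrop Γ X = snd X (ctx Γ) := by
  simp [ctxDrop]

theorem ctxExt_hom_last : (Γ : List C) → (X : C) →
    (ctxExt Γ X).hom ≫ ctxLast Γ X = fst X (ctx Γ)
  | [], X => by
    change (ρ_ X).hom ≫ 𝟙 X = fst X (𝟙_ C)
    rw [Category.comp_id, rightUnitor_hom]
  | Y :: Γ, X => Category.id_comp _

theorem ctxExt_inv_eq (Γ : List C) (X : C) :
    (ctxExt Γ X).inv = lift (ctxLast Γ X) (ctxDrop Γ X) := by
  rw [← cancel_epi (ctxExt Γ X).hom, comp_lift, ctxExt_hom_last, ctxExt_hom_drop]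
  simp

/-- The generalised element `(x, γ)` of the context `Γ, X`. -/
def ctxCons {Γ : List C} {X Z : C} (x : Z ⟶ X) (γ : Z ⟶ ctx Γ) : Z ⟶ ctx (X :: Γ) :=
  lift x γ ≫ (ctxExt Γ X).hom

theorem ctxCons_last {Γ : List C} {X Z : C} (x : Z ⟶ X) (γ : Z ⟶ ctx Γ) :
    ctxCons x γ ≫ ctxLast Γ X = x := by
  rw [ctxCons, Category.assoc, ctxExt_hom_last, lift_fst]

theorem ctxCons_drop {Γ : List C} {X Z : C} (x : Z ⟶ X) (γ : Z ⟶ ctx Γ) :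
    ctxCons x γ ≫ ctxDrop Γ X = γ := by
  rw [ctxCons, Category.assoc, ctxExt_hom_drop, lift_snd]

theorem ctxCons_zero {Γ : List C} {X Z : C} (x : Z ⟶ X) (γ : Z ⟶ ctx Γ) :
    ctxCons x γ ≫ (Var.zero : Var (X :: Γ) X).interp = x := ctxCons_last x γ

theorem ctxCons_succ {Γ : List C} {X Y Z : C} (x : Z ⟶ X) (γ : Z ⟶ ctx Γ) (y : Var Γ Y) :
    ctxCons x γ ≫ (Var.succ y : Var (X :: Γ) Y).interp = γ ≫ y.interp := by
  rw [Var.interp, ← Category.assoc, ctxCons_drop]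

theorem ctx_hom_ext {Γ : List C} {X Z : C} {f g : Z ⟶ ctx (X :: Γ)}
    (h : f ≫ ctxLast Γ X = g ≫ ctxLast Γ X) (h' : f ≫ ctxDrop Γ X = g ≫ ctxDrop Γ X) : f = g := by
  rw [← cancel_mono (ctxExt Γ X).inv, ctxExt_inv_eq, comp_lift, comp_lift, h, h']

/-- The extension of a morphism of contexts by a variable. -/
def ctxMap {Γ Δ : List C} (X : C) (r : ctx Δ ⟶ ctx Γ) : ctx (X :: Δ) ⟶ ctx (X :: Γ) :=
  ctxCons (ctxLast Δ X) (ctxDrop Δ X ≫ r)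

theorem ctxMap_lift {Γ Δ : List C} (ρ : ∀ X : C, Var Γ X → Var Δ X) (r : ctx Δ ⟶ ctx Γ)
    (h : ∀ (X : C) (x : Var Γ X), (ρ X x).interp = r ≫ x.interp) (Y X : C) :
    ∀ x : Var (Y :: Γ) X, (Var.lift ρ Y X x).interp = ctxMap Y r ≫ x.interp
  | .zero => (ctxCons_zero _ _).symm
  | .succ x => by
    rw [ctxMap, ctxCons_succ, Category.assoc, ← h]
    rfl

theorem ctxExt_hom_ctxMap {Γ Δ : List C} (X : C) (r : ctx Δ ⟶ ctx Γ) :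
    (ctxExt Δ X).hom ≫ ctxMap X r = X ◁ r ≫ (ctxExt Γ X).hom := by
  apply ctx_hom_ext
  · rw [ctxMap, Category.assoc, ctxCons_last, Category.assoc, ctxExt_hom_last, ctxExt_hom_last,
      whiskerLeft_fst]
  · rw [ctxMap, Category.assoc, ctxCons_drop, Category.assoc, ctxExt_hom_drop,
      ← Category.assoc, ctxExt_hom_drop, whiskerLeft_snd]

theorem pullback_ctxExt_ctxMap [HasFiniteLimits C] {Γ Δ : List C} (X : C) (r : ctx Δ ⟶ ctx Γ)
    (S : Subobject (ctx (X :: Γ))) :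
    (Subobject.pullback (ctxExt Δ X).hom).obj ((Subobject.pullback (ctxMap X r)).obj S) =
      (Subobject.pullback (X ◁ r)).obj ((Subobject.pullback (ctxExt Γ X).hom).obj S) := by
  refine ext_factors fun Z g => ?_
  simp only [Limits.pullback_factors_iff, Category.assoc, ctxExt_hom_ctxMap]

theorem comp_ctxCons {Γ : List C} {X Z W : C} (e : W ⟶ Z) (x : Z ⟶ X) (γ : Z ⟶ ctx Γ) :
    e ≫ ctxCons x γ = ctxCons (e ≫ x) (e ≫ γ) := by
  rw [ctxCons, ctxCons, ← Category.assoc, comp_lift]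

/-- A generalised element of a context with one variable. -/
def ctxOne {X Z : C} (x : Z ⟶ X) : Z ⟶ ctx [X] := x

theorem ctxOne_zero {X Z : C} (x : Z ⟶ X) :
    ctxOne x ≫ (Var.zero : Var [X] X).interp = x := Category.comp_id x

/-- The generalised element `(γ, a₁, …, aₙ)` of the context `Γ, a₁ : A, …, aₙ : A`. -/
def ctxAppendCons {Γ : List C} {A Z : C} (γ : Z ⟶ ctx Γ) :
    (n : ℕ) → (Fin n → (Z ⟶ A)) → (Z ⟶ ctx (ctxAppend Γ A n))
  | 0, _ => γ
  | n + 1, a => ctxCons (a (Fin.last n)) (ctxAppendCons γ n fun i => a i.castSucc)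

theorem comp_ctxAppendCons {Γ : List C} {A Z W : C} (e : W ⟶ Z) (γ : Z ⟶ ctx Γ) :
    (n : ℕ) → (a : Fin n → (Z ⟶ A)) →
      e ≫ ctxAppendCons γ n a = ctxAppendCons (e ≫ γ) n fun i => e ≫ a i
  | 0, _ => rfl
  | n + 1, _ => (comp_ctxCons e _ _).trans (congrArg (ctxCons _) (comp_ctxAppendCons e γ n _))

theorem ctxAppendCons_newVar {Γ : List C} {A Z : C} (γ : Z ⟶ ctx Γ) :
    (n : ℕ) → (a : Fin n → (Z ⟶ A)) → (i : Fin n) →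
      ctxAppendCons γ n a ≫ (newVar Γ A n i).interp = a i
  | 0, _, i => i.elim0
  | n + 1, a, i => by
    induction i using Fin.lastCases with
    | last =>
      rw [newVar_last]
      exact ctxCons_zero _ _
    | cast i =>
      rw [newVar_castSucc]
      exact (ctxCons_succ _ _ _).trans (ctxAppendCons_newVar γ n (fun i => a i.castSucc) i)

theorem ctxAppendCons_oldVar {Γ : List C} {A X Z : C} (γ : Z ⟶ ctx Γ) (x : Var Γ X) :
    (n : ℕ) → (a : Fin n → (Z ⟶ A)) →
      ctxAppendCons γ n a ≫ (oldVar A x n).interp = γ ≫ x.interp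
  | 0, _ => rfl
  | n + 1, _ => (ctxCons_succ _ _ _).trans (ctxAppendCons_oldVar γ x n _)

end Contexts

section Substitution

variable {C : Type u} [Category.{v} C] [CartesianMonoidalCategory C] [MonoidalClosed C]
  [HasFiniteLimits C] [HasCountableColimits C] {cl : Subobject.Classifier C}

/-- The image of a subobject `S` along `d`, in terms of generalised elements. -/
theorem im_arrow_factors_iff (cl : Subobject.Classifier C) {X Y Z : C} (S : Subobject X)
    (d : X ⟶ Y) (g : Z ⟶ Y) : (im (S.arrow ≫ d)).Factors g ↔
      ∃ (W : C) (e : W ⟶ Z) (y : W ⟶ X), Epi e ∧ S.Factors y ∧ y ≫ d = e ≫ g := by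
  rw [im_factors_iff cl]
  constructor
  · rintro ⟨W, e, y, he, h⟩
    exact ⟨W, e, y ≫ S.arrow, he, Subobject.factors_comp_arrow _, by rw [Category.assoc, h]⟩
  · rintro ⟨W, e, y, he, hy, h⟩
    exact ⟨W, e, S.factorThru y hy, he, by rw [← Category.assoc, Subobject.factorThru_arrow, h]⟩

theorem pullback_im_ctxDrop (cl : Subobject.Classifier C) {Γ Δ : List C} (X : C)
    (r : ctx Δ ⟶ ctx Γ) (S : Subobject (ctx (X :: Γ))) :
    im (((Subobject.pullback (ctxMap X r)).obj S).arrow ≫ ctxDrop Δ X) =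
      (Subobject.pullback r).obj (im (S.arrow ≫ ctxDrop Γ X)) := by
  refine ext_factors fun Z g => ?_
  rw [Limits.pullback_factors_iff, im_arrow_factors_iff cl, im_arrow_factors_iff cl]
  constructor
  · rintro ⟨W, e, y, he, hy, h⟩
    refine ⟨W, e, y ≫ ctxMap X r, he, (Limits.pullback_factors_iff _ _ _).1 hy, ?_⟩
    rw [Category.assoc, ctxMap, ctxCons_drop, ← Category.assoc, h, Category.assoc]
  · rintro ⟨W, e, y, he, hy, h⟩
    refine ⟨W, e, ctxCons (y ≫ ctxLast Γ X) (e ≫ g), he, ?_, ctxCons_drop _ _⟩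
    rw [Limits.pullback_factors_iff]
    convert hy using 1
    apply ctx_hom_ext
    · rw [ctxMap, Category.assoc, ctxCons_last, ctxCons_last]
    · rw [ctxMap, Category.assoc, ctxCons_drop, ← Category.assoc, ctxCons_drop, h, Category.assoc]

mutual

theorem Tm.interpAux_rename : {Γ : List C} → {X : C} → (t : Tm cl Γ X) → {Δ : List C} →
    (ρ : ∀ X : C, Var Γ X → Var Δ X) → (r : ctx Δ ⟶ ctx Γ) →
    (∀ (X : C) (x : Var Γ X), (ρ X x).interp = r ≫ x.interp) →
    (t.rename ρ).interpAux.down = r ≫ t.interpAux.down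
  | _, _, .var x, _, ρ, r, h => by simp only [Tm.rename, Tm.interpAux, h]
  | _, _, .star, _, ρ, r, h => toUnit_unique _ _
  | _, _, .pair t s, _, ρ, r, h => by
    simp only [Tm.rename, Tm.interpAux, Tm.interpAux_rename t ρ r h, Tm.interpAux_rename s ρ r h,
      comp_lift]
  | _, _, .proj₁ t, _, ρ, r, h => by
    simp only [Tm.rename, Tm.interpAux, Tm.interpAux_rename t ρ r h, Category.assoc]
  | _, _, .proj₂ t, _, ρ, r, h => by
    simp only [Tm.rename, Tm.interpAux, Tm.interpAux_rename t ρ r h, Category.assoc]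
  | _, _, .app f t, _, ρ, r, h => by
    simp only [Tm.rename, Tm.interpAux, Tm.interpAux_rename t ρ r h, Category.assoc]
  | _, _, .compr p, _, ρ, r, h => by
    simp only [Tm.rename, Tm.interpAux, Fm.interp_rename p _ _ (ctxMap_lift ρ r h _),
      pullback_ctxExt_ctxMap, transpose_pullback]

theorem Fm.interp_rename : {Γ : List C} → (p : Fm cl Γ) → {Δ : List C} →
    (ρ : ∀ X : C, Var Γ X → Var Δ X) → (r : ctx Δ ⟶ ctx Γ) →
    (∀ (X : C) (x : Var Γ X), (ρ X x).interp = r ≫ x.interp) →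
    (p.rename ρ).interp = (Subobject.pullback r).obj p.interp
  | _, .top, _, ρ, r, h => (Subobject.pullback_top _).symm
  | _, .bot, _, ρ, r, h => (pullback_falsum cl r).symm
  | _, .rel R t, _, ρ, r, h => by
    simp only [Fm.rename, Fm.interp, Tm.interpAux_rename t ρ r h, Subobject.pullback_comp]
  | _, .eq t s, _, ρ, r, h => by
    simp only [Fm.rename, Fm.interp, Tm.interpAux_rename t ρ r h, Tm.interpAux_rename s ρ r h,
      pullback_equalizerSubobject]
  | _, .and p q, _, ρ, r, h => by
    simp only [Fm.rename, Fm.interp, Fm.interp_rename p ρ r h, Fm.interp_rename q ρ r h,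
      Subobject.inf_pullback]
  | _, .or p q, _, ρ, r, h => by
    simp only [Fm.rename, Fm.interp, Fm.interp_rename p ρ r h, Fm.interp_rename q ρ r h,
      pullback_union cl]
  | _, .imp p q, _, ρ, r, h => by
    simp only [Fm.rename, Fm.interp, Fm.interp_rename p ρ r h, Fm.interp_rename q ρ r h,
      pullback_imp]
  | _, .iOr p, _, ρ, r, h => by
    simp only [Fm.rename, Fm.interp, fun i => Fm.interp_rename (p i) ρ r h, pullback_iUnion cl]
  | _, .all p, _, ρ, r, h => by
    simp only [Fm.rename, Fm.interp, Fm.interp_rename p _ _ (ctxMap_lift ρ r h _),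
      pullback_ctxExt_ctxMap, pullback_univ]
  | _, .ex p, _, ρ, r, h => by
    simp only [Fm.rename, Fm.interp]
    rw [Fm.interp_rename p _ _ (ctxMap_lift ρ r h _), pullback_im_ctxDrop cl]
  | _, .mem t T, _, ρ, r, h => by
    simp only [Fm.rename, Fm.interp, Tm.interpAux_rename t ρ r h, Tm.interpAux_rename T ρ r h,
      ← Subobject.pullback_comp, comp_lift]

end

/-- The morphism denoted by a term with one free variable. -/
noncomputable def Tm.hom {A B : C} (t : Tm cl [A] B) : A ⟶ B := t.interp

theorem Tm.interp_at {A B : C} (t : Tm cl [A] B) {Γ : List C} (x : Var Γ A) :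
    (t.at x).interp = x.interp ≫ t.hom := by
  refine Tm.interpAux_rename t _ x.interp fun X y => ?_
  cases y with
  | zero => exact (Category.comp_id _).symm
  | succ y => cases y

end Substitution

section Forcing

variable {C : Type u} [Category.{v} C] [CartesianMonoidalCategory C] [MonoidalClosed C]
  [HasFiniteLimits C] [HasCountableColimits C] {cl : Subobject.Classifier C}

theorem Tm.interp_var {Γ : List C} {X : C} (x : Var Γ X) :
    (Tm.var x : Tm cl Γ X).interp = x.interp := by
  simp only [Tm.interp, Tm.interpAux]

theorem Tm.interp_pair {Γ : List C} {X Y : C} (t : Tm cl Γ X) (s : Tm cl Γ Y) :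
    (t.pair s).interp = lift t.interp s.interp := by
  simp only [Tm.interp, Tm.interpAux]

theorem Fm.interp_or {Γ : List C} (p q : Fm cl Γ) :
    (Fm.or p q).interp = union p.interp q.interp := by
  simp only [Fm.interp]

theorem Fm.interp_iOr {Γ : List C} (p : ℕ → Fm cl Γ) :
    (Fm.iOr p).interp = iUnion fun i => (p i).interp := by
  simp only [Fm.interp]

theorem Fm.eq_factors_iff {Γ : List C} {X Z : C} (t s : Tm cl Γ X) (γ : Z ⟶ ctx Γ) :
    (Fm.eq t s).interp.Factors γ ↔ γ ≫ t.interp = γ ≫ s.interp := by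
  simp only [Fm.interp, equalizerSubobject_factors, Tm.interp]

theorem Fm.and_factors_iff {Γ : List C} {Z : C} (p q : Fm cl Γ) (γ : Z ⟶ ctx Γ) :
    (Fm.and p q).interp.Factors γ ↔ p.interp.Factors γ ∧ q.interp.Factors γ := by
  simp only [Fm.interp, Subobject.inf_factors]

theorem Fm.ex_factors_iff {Γ : List C} {X Z : C} (p : Fm cl (X :: Γ)) (γ : Z ⟶ ctx Γ) :
    (Fm.ex p).interp.Factors γ ↔ ∃ (W : C) (e : W ⟶ Z) (x : W ⟶ X), Epi e ∧
      p.interp.Factors (ctxCons x (e ≫ γ)) := by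
  simp only [Fm.interp]
  rw [im_arrow_factors_iff cl]
  constructor
  · rintro ⟨W, e, y, he, hy, h⟩
    refine ⟨W, e, y ≫ ctxLast Γ X, he, ?_⟩
    convert hy using 1
    apply ctx_hom_ext
    · rw [ctxCons_last]
    · rw [ctxCons_drop, h]
  · rintro ⟨W, e, x, he, hx⟩
    exact ⟨W, e, _, he, hx, ctxCons_drop _ _⟩

theorem Fm.mem_compr_factors_iff {Γ : List C} {X Z : C} (t : Tm cl Γ X) (p : Fm cl (X :: Γ))
    (γ : Z ⟶ ctx Γ) : (Fm.mem t (.compr p)).interp.Factors γ ↔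
      p.interp.Factors (ctxCons (γ ≫ t.interp) γ) := by
  simp only [Fm.interp, Tm.interpAux]
  rw [Limits.pullback_factors_iff, comp_lift, ← transpose_pullback, membership_factors_iff,
    Limits.pullback_factors_iff, Limits.pullback_factors_iff, ctxCons]
  simp [Tm.interp]

theorem finAnd_factors_iff {Γ : List C} {Z : C} (γ : Z ⟶ ctx Γ) :
    (n : ℕ) → (p : Fin n → Fm cl Γ) →
      ((finAnd n p).interp.Factors γ ↔ ∀ i, (p i).interp.Factors γ)
  | 0, p => by
    simp only [finAnd, Fm.interp, IsEmpty.forall_iff, iff_true]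
    exact Subobject.top_factors _
  | n + 1, p => by
    rw [finAnd, Fm.and_factors_iff, finAnd_factors_iff γ n, Fin.forall_fin_succ']

theorem finOr_le_iff {Γ : List C} (U : Subobject (ctx Γ)) : (n : ℕ) → (p : Fin n → Fm cl Γ) →
    ((finOr n p).interp ≤ U ↔ ∀ i, (p i).interp ≤ U)
  | 0, p => by
    simp only [finOr, Fm.interp, IsEmpty.forall_iff, iff_true]
    exact falsum_le cl _
  | n + 1, p => by
    simp only [finOr, Fm.interp]
    rw [union_le_iff cl, finOr_le_iff U n, Fin.forall_fin_succ']

theorem pullback_finOr {Γ Δ : List C} {X : C} (f : X ⟶ ctx Γ) (g : X ⟶ ctx Δ) : (n : ℕ) →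
    (p : Fin n → Fm cl Γ) → (q : Fin n → Fm cl Δ) →
    (∀ i, (Subobject.pullback f).obj (p i).interp = (Subobject.pullback g).obj (q i).interp) →
    (Subobject.pullback f).obj (finOr n p).interp = (Subobject.pullback g).obj (finOr n q).interp
  | 0, p, q, h => by
    simp only [finOr, Fm.interp, pullback_falsum cl]
  | n + 1, p, q, h => by
    simp only [finOr, Fm.interp, pullback_union cl]
    rw [h, pullback_finOr f g n _ _ fun i => h i.castSucc]

theorem exMany_factors_iff {Γ : List C} (A : C) {Z : C} (γ : Z ⟶ ctx Γ) :
    (n : ℕ) → (p : Fm cl (ctxAppend Γ A n)) → ((exMany A n p).interp.Factors γ ↔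
      ∃ (W : C) (e : W ⟶ Z) (a : Fin n → (W ⟶ A)), Epi e ∧
        p.interp.Factors (ctxAppendCons (e ≫ γ) n a))
  | 0, p => by
    constructor
    · intro h
      exact ⟨Z, 𝟙 Z, Fin.elim0, inferInstance, by
        rw [Category.id_comp]
        exact h⟩
    · rintro ⟨W, e, a, he, h⟩
      exact factors_of_epi cl _ e h
  | n + 1, p => by
    rw [exMany, exMany_factors_iff A γ n]
    constructor
    · rintro ⟨W, e, a, he, h⟩
      obtain ⟨V, d, x, hd, hx⟩ := (Fm.ex_factors_iff _ _).1 h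
      refine ⟨V, d ≫ e, Fin.snoc (fun i => d ≫ a i) x, inferInstance, ?_⟩
      rw [comp_ctxAppendCons, ← Category.assoc] at hx
      have key : ctxAppendCons ((d ≫ e) ≫ γ) (n + 1) (Fin.snoc (fun i => d ≫ a i) x) =
          ctxCons x (ctxAppendCons ((d ≫ e) ≫ γ) n fun i => d ≫ a i) := by
        simp only [ctxAppendCons, Fin.snoc_last, Fin.snoc_castSucc]
        rfl
      rw [key]
      exact hx
    · rintro ⟨W, e, a, he, h⟩
      refine ⟨W, e, fun i => a i.castSucc, he, (Fm.ex_factors_iff _ _).2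
        ⟨W, 𝟙 W, a (Fin.last n), inferInstance, ?_⟩⟩
      rw [Category.id_comp]
      exact h

/-- A zig-zag of type `α` between generalised elements. -/
def IsZigzag {A B Z : C} (t : Fin 2 → (A ⟶ B)) (x y : Z ⟶ B) (n : ℕ) (α : Fin (n + 1) → Fin 2)
    (a : Fin (n + 1) → (Z ⟶ A)) : Prop :=
  x = a 0 ≫ t (α 0) ∧ (∀ i : Fin n, a i.castSucc ≫ t (α i.castSucc + 1) = a i.succ ≫ t (α i.succ)) ∧
    a (Fin.last n) ≫ t (α (Fin.last n) + 1) = y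

theorem zigzag_factors_iff {A B : C} (t : Fin 2 → Tm cl [A] B) {Γ : List C} (b₁ b₂ : Var Γ B)
    (n : ℕ) (α : Fin (n + 1) → Fin 2) {Z : C} (γ : Z ⟶ ctx Γ) :
    (zigzag t b₁ b₂ n α).interp.Factors γ ↔ ∃ (W : C) (e : W ⟶ Z) (a : Fin (n + 1) → (W ⟶ A)),
      Epi e ∧ IsZigzag (fun i => (t i).hom) (e ≫ γ ≫ b₁.interp) (e ≫ γ ≫ b₂.interp) n α a := by
  rw [zigzag, exMany_factors_iff]
  refine exists_congr fun W => exists_congr fun e => exists_congr fun a => and_congr_right fun _ => ?_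
  have h (i : Fin 2) (j : Fin (n + 1)) : ctxAppendCons (e ≫ γ) (n + 1) a ≫
      ((t i).at (newVar Γ A (n + 1) j)).interp = a j ≫ (t i).hom := by
    rw [Tm.interp_at, ← Category.assoc, ctxAppendCons_newVar]
  simp only [Fm.and_factors_iff, Fm.eq_factors_iff, finAnd_factors_iff, h, Tm.interp_var,
    ctxAppendCons_oldVar, IsZigzag, Category.assoc, and_assoc]

end Forcing

section Zigzag

variable {C : Type u} [Category.{v} C]

theorem IsZigzag.single {A B Z : C} {t : Fin 2 → (A ⟶ B)} (a : Z ⟶ A) (i : Fin 2) :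
    IsZigzag t (a ≫ t i) (a ≫ t (i + 1)) 0 (fun _ => i) fun _ => a :=
  ⟨rfl, fun i => i.elim0, rfl⟩

theorem IsZigzag.cons {A B Z : C} {t : Fin 2 → (A ⟶ B)} {y : Z ⟶ B} {n : ℕ}
    {α : Fin (n + 1) → Fin 2} {a : Fin (n + 1) → (Z ⟶ A)} (a₀ : Z ⟶ A) (i : Fin 2)
    (h : IsZigzag t (a₀ ≫ t (i + 1)) y n α a) :
    IsZigzag t (a₀ ≫ t i) y (n + 1) (Fin.cons i α : Fin (n + 2) → Fin 2)
      (Fin.cons a₀ a : Fin (n + 2) → (Z ⟶ A)) := by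
  refine ⟨rfl, fun j => ?_, ?_⟩
  · induction j using Fin.cases with
    | zero => exact h.1
    | succ j => exact h.2.1 j
  · exact h.2.2

theorem IsZigzag.comp_eq {A B Z Y : C} {t : Fin 2 → (A ⟶ B)} {x y : Z ⟶ B} {n : ℕ}
    {α : Fin (n + 1) → Fin 2} {a : Fin (n + 1) → (Z ⟶ A)} (h : IsZigzag t x y n α a) (f : B ⟶ Y)
    (hf : ∀ i j, t i ≫ f = t j ≫ f) : x ≫ f = y ≫ f := by
  have key (j : Fin (n + 1)) : x ≫ f = a j ≫ t 0 ≫ f := by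
    induction j using Fin.induction with
    | zero => rw [h.1, Category.assoc, hf (α 0) 0]
    | succ j ih =>
      rw [ih, hf 0 (α j.succ), ← Category.assoc (a j.succ), ← h.2.1 j, Category.assoc,
        hf (α j.castSucc + 1)]
  rw [key (Fin.last n), ← h.2.2, Category.assoc, hf 0]

end Zigzag

section Connected

variable {C : Type u} [Category.{v} C] [CartesianMonoidalCategory C] [MonoidalClosed C]
  [HasFiniteLimits C] [HasCountableColimits C] {cl : Subobject.Classifier C} {A B : C}
  (t₀ t₁ : Tm cl [A] B)

theorem pullback_connected_congr {Γ Δ : List C} {Z : C} (b₁ b₂ : Var Γ B) (b₁' b₂' : Var Δ B)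
    (γ : Z ⟶ ctx Γ) (δ : Z ⟶ ctx Δ) (h₁ : γ ≫ b₁.interp = δ ≫ b₁'.interp)
    (h₂ : γ ≫ b₂.interp = δ ≫ b₂'.interp) :
    (Subobject.pullback γ).obj (connected t₀ t₁ b₁ b₂).interp =
      (Subobject.pullback δ).obj (connected t₀ t₁ b₁' b₂').interp := by
  simp only [connected, Fm.interp, pullback_union cl, pullback_iUnion cl]
  congr 1
  · rw [pullback_equalizerSubobject, pullback_equalizerSubobject]
    change equalizerSubobject (γ ≫ (Tm.var b₁).interp) (γ ≫ (Tm.var b₂).interp) =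
      equalizerSubobject (δ ≫ (Tm.var b₁').interp) (δ ≫ (Tm.var b₂').interp)
    simp only [Tm.interp_var, h₁, h₂]
  · congr 1
    funext n
    refine pullback_finOr _ _ _ _ _ fun k => ext_factors fun W g => ?_
    simp only [Limits.pullback_factors_iff, zigzag_factors_iff, Category.assoc, h₁, h₂]

theorem pullback_connected_le {Γ : List C} {Z : C} (b₁ b₂ : Var Γ B) (γ : Z ⟶ ctx Γ)
    (T : Subobject Z)
    (heq : ∀ (W : C) (e : W ⟶ Z), e ≫ γ ≫ b₁.interp = e ≫ γ ≫ b₂.interp → T.Factors e)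
    (hzz : ∀ (W : C) (e : W ⟶ Z) (n : ℕ) (α : Fin (n + 1) → Fin 2) (a : Fin (n + 1) → (W ⟶ A)),
      IsZigzag (fun i => (![t₀, t₁] i).hom) (e ≫ γ ≫ b₁.interp) (e ≫ γ ≫ b₂.interp) n α a →
        T.Factors e) :
    (Subobject.pullback γ).obj (connected t₀ t₁ b₁ b₂).interp ≤ T := by
  obtain ⟨U, hU⟩ := exists_forall_along cl γ T
  rw [← hU]
  rw [connected, Fm.interp_or, Fm.interp_iOr]
  rw [union_le_iff cl, iUnion_le_iff cl]
  refine ⟨?_, fun n => (finOr_le_iff _ _ _).2 fun k => ?_⟩ <;>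
    rw [hU, le_iff_forall_factors] <;> intro W g hg <;> rw [Limits.pullback_factors_iff] at hg
  · rw [Fm.eq_factors_iff, Tm.interp_var, Tm.interp_var, Category.assoc, Category.assoc] at hg
    exact heq W g hg
  · obtain ⟨V, e, a, he, h⟩ := (zigzag_factors_iff _ _ _ _ _ _).1 hg
    refine factors_of_epi cl _ e (hzz V _ n (finFunctionFinEquiv.symm k) a ?_)
    simpa only [Category.assoc] using h

theorem connected_factors_of_eq {Γ : List C} {Z : C} (b₁ b₂ : Var Γ B) (γ : Z ⟶ ctx Γ)
    (h : γ ≫ b₁.interp = γ ≫ b₂.interp) : (connected t₀ t₁ b₁ b₂).interp.Factors γ := by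
  rw [connected, Fm.interp_or]
  refine Subobject.factors_of_le _ ((union_le_iff cl _ _ _).1 le_rfl).1 ?_
  rwa [Fm.eq_factors_iff, Tm.interp_var, Tm.interp_var]

theorem connected_factors_of_isZigzag {Γ : List C} {Z : C} (b₁ b₂ : Var Γ B) (γ : Z ⟶ ctx Γ)
    {n : ℕ} {α : Fin (n + 1) → Fin 2} {a : Fin (n + 1) → (Z ⟶ A)}
    (h : IsZigzag (fun i => (![t₀, t₁] i).hom) (γ ≫ b₁.interp) (γ ≫ b₂.interp) n α a) :
    (connected t₀ t₁ b₁ b₂).interp.Factors γ := by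
  rw [connected, Fm.interp_or, Fm.interp_iOr]
  refine Subobject.factors_of_le _ ((union_le_iff cl _ _ _).1 le_rfl).2 ?_
  refine Subobject.factors_of_le _ ((iUnion_le_iff cl _ _).1 le_rfl n) ?_
  refine Subobject.factors_of_le _ ((finOr_le_iff _ _ _).1 le_rfl (finFunctionFinEquiv α)) ?_
  rw [zigzag_factors_iff, Equiv.symm_apply_apply]
  exact ⟨Z, 𝟙 Z, a, inferInstance, by simpa only [Category.id_comp] using h⟩

/-- Two generalised elements of `B` are equal or locally connected by a zig-zag. -/
def Conn {Z : C} (x y : Z ⟶ B) : Prop :=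
  (connected t₀ t₁ (Γ := [B, B]) (.succ .zero) .zero).interp.Factors
    (ctxCons y (ctxOne x))

theorem connected_factors_iff {Γ : List C} {Z : C} (b₁ b₂ : Var Γ B) (γ : Z ⟶ ctx Γ) :
    (connected t₀ t₁ b₁ b₂).interp.Factors γ ↔
      Conn t₀ t₁ (γ ≫ b₁.interp) (γ ≫ b₂.interp) := by
  have h := pullback_connected_congr t₀ t₁ b₁ b₂ (.succ .zero : Var [B, B] B) .zero γ
    (ctxCons (γ ≫ b₂.interp) (ctxOne (γ ≫ b₁.interp)))
    (by rw [ctxCons_succ, ctxOne_zero]) (by rw [ctxCons_zero])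
  have h' := congrArg (fun S => S.Factors (𝟙 Z)) h
  simp only [Limits.pullback_factors_iff, Category.id_comp] at h'
  exact iff_of_eq h'

theorem Conn.refl {Z : C} (x : Z ⟶ B) : Conn t₀ t₁ x x :=
  connected_factors_of_eq _ _ _ _ _ (by rw [ctxCons_succ, ctxOne_zero, ctxCons_zero])

variable {t₀ t₁}

theorem Conn.of_isZigzag {Z : C} {x y : Z ⟶ B} {n : ℕ} {α : Fin (n + 1) → Fin 2}
    {a : Fin (n + 1) → (Z ⟶ A)} (h : IsZigzag (fun i => (![t₀, t₁] i).hom) x y n α a) :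
    Conn t₀ t₁ x y :=
  connected_factors_of_isZigzag _ _ _ _ _ (by
    rw [ctxCons_succ, ctxOne_zero, ctxCons_zero]
    exact h)

theorem Conn.elim {Z : C} {x y : Z ⟶ B} (h : Conn t₀ t₁ x y) (T : Subobject Z)
    (heq : ∀ (W : C) (e : W ⟶ Z), e ≫ x = e ≫ y → T.Factors e)
    (hzz : ∀ (W : C) (e : W ⟶ Z) (n : ℕ) (α : Fin (n + 1) → Fin 2) (a : Fin (n + 1) → (W ⟶ A)),
      IsZigzag (fun i => (![t₀, t₁] i).hom) (e ≫ x) (e ≫ y) n α a → T.Factors e) :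
    T.Factors (𝟙 Z) := by
  have key := pullback_connected_le t₀ t₁ (.succ .zero : Var [B, B] B) .zero
    (ctxCons y (ctxOne x)) T
  rw [ctxCons_succ, ctxOne_zero, ctxCons_zero] at key
  refine Subobject.factors_of_le _ (key heq hzz) ?_
  rw [Limits.pullback_factors_iff, Category.id_comp]
  exact h

theorem Conn.comp_eq {Z Y : C} {x y : Z ⟶ B} (h : Conn t₀ t₁ x y) (f : B ⟶ Y)
    (hf : t₀.hom ≫ f = t₁.hom ≫ f) : x ≫ f = y ≫ f := by
  have hf' : ∀ i j, (![t₀, t₁] i).hom ≫ f = (![t₀, t₁] j).hom ≫ f := by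
    simp [Fin.forall_fin_two, hf]
  have := h.elim (equalizerSubobject (x ≫ f) (y ≫ f))
    (fun W e he => by
      rw [equalizerSubobject_factors, ← Category.assoc, he, Category.assoc])
    (fun W e n α a hz => by
      rw [equalizerSubobject_factors, ← Category.assoc, hz.comp_eq f hf', Category.assoc])
  simpa only [equalizerSubobject_factors, Category.id_comp] using this

theorem Conn.step {Z : C} {y : Z ⟶ B} (a : Z ⟶ A) (i : Fin 2)
    (h : Conn t₀ t₁ (a ≫ (![t₀, t₁] (i + 1)).hom) y) : Conn t₀ t₁ (a ≫ (![t₀, t₁] i).hom) y := by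
  have key {W : C} (e : W ⟶ Z) : ((Subobject.pullback (ctxCons y
      (ctxOne (a ≫ (![t₀, t₁] i).hom)))).obj
      (connected t₀ t₁ (Γ := [B, B]) (.succ .zero) .zero).interp).Factors e ↔
      Conn t₀ t₁ ((e ≫ a) ≫ (![t₀, t₁] i).hom) (e ≫ y) := by
    rw [Limits.pullback_factors_iff, connected_factors_iff]
    simp only [Category.assoc, ctxCons_succ, ctxCons_zero, ctxOne_zero]
  have := h.elim _ (fun W e he => (key e).2 ?_) (fun W e n α a' hz => (key e).2 ?_)
  · simpa only [Category.id_comp] using (key (𝟙 Z)).1 this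
  · rw [← he, ← Category.assoc]
    exact .of_isZigzag (.single (t := fun i => (![t₀, t₁] i).hom) (e ≫ a) i)
  · rw [← Category.assoc] at hz
    exact .of_isZigzag (hz.cons (t := fun i => (![t₀, t₁] i).hom) (e ≫ a) i)

variable (t₀ t₁)

theorem mem_relTm_factors_iff {Γ : List C} {Z : C} (b₁ b₂ : Var Γ B) (γ : Z ⟶ ctx Γ) :
    (Fm.mem (.pair (.var b₁) (.var b₂)) (relTm t₀ t₁ Γ)).interp.Factors γ ↔
      Conn t₀ t₁ (γ ≫ b₁.interp) (γ ≫ b₂.interp) := by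
  rw [relTm, Fm.mem_compr_factors_iff]
  simp only [Fm.ex_factors_iff, Fm.and_factors_iff, Fm.eq_factors_iff, Tm.interp_pair,
    Tm.interp_var, comp_lift, ctxCons_succ, ctxCons_zero, comp_ctxCons, connected_factors_iff]
  constructor
  · rintro ⟨W, e, x, he, V, d, y, hd, hxy, h⟩
    refine (connected_factors_iff t₀ t₁ b₁ b₂ γ).1 (factors_of_epi cl _ (d ≫ e) ?_)
    rw [connected_factors_iff]
    have h₁ := congrArg (· ≫ fst B B) hxy
    have h₂ := congrArg (· ≫ snd B B) hxy
    simp only [lift_fst, lift_snd] at h₁ h₂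
    simpa only [Category.assoc, h₁, h₂] using h
  · intro h
    refine ⟨Z, 𝟙 Z, γ ≫ b₁.interp, inferInstance, Z, 𝟙 Z, γ ≫ b₂.interp, inferInstance, ?_⟩
    simpa only [Category.id_comp, true_and] using h

theorem comp_classTm_eq_iff {Γ Δ : List C} {Z : C} (b : Var Γ B) (b' : Var Δ B) (γ : Z ⟶ ctx Γ)
    (δ : Z ⟶ ctx Δ) : γ ≫ (classTm t₀ t₁ b).interp = δ ≫ (classTm t₀ t₁ b').interp ↔
      ∀ (W : C) (e : W ⟶ Z) (y : W ⟶ B),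
        Conn t₀ t₁ (e ≫ γ ≫ b.interp) y ↔ Conn t₀ t₁ (e ≫ δ ≫ b'.interp) y := by
  have key {Γ : List C} (b : Var Γ B) (γ : Z ⟶ ctx Γ) {W : C} (y : W ⟶ B) (e : W ⟶ Z) :
      ((Subobject.pullback (B ◁ γ)).obj ((Subobject.pullback (ctxExt Γ B).hom).obj
        (Fm.mem (.pair (.var (.succ b)) (.var .zero)) (relTm t₀ t₁ (B :: Γ))).interp)).Factors
        (lift y e) ↔ Conn t₀ t₁ (e ≫ γ ≫ b.interp) y := by
    have h : (lift y e ≫ B ◁ γ) ≫ (ctxExt Γ B).hom = ctxCons y (e ≫ γ) := by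
      rw [lift_whiskerLeft, ctxCons]
    rw [Limits.pullback_factors_iff, Limits.pullback_factors_iff, h, mem_relTm_factors_iff,
      ctxCons_succ, ctxCons_zero, Category.assoc]
  simp only [classTm, Tm.interp, Tm.interpAux, ← transpose_pullback]
  constructor
  · intro h W e y
    rw [← key, ← key, transpose_injective cl h]
  · intro h
    congr 1
    refine ext_factors fun W g => ?_
    have e : g = lift (g ≫ fst B Z) (g ≫ snd B Z) := by ext <;> simp
    rw [e, key, key, h]

/-- The morphism `⟦b : B. [b]⟧`. -/
noncomputable def classMap : B ⟶ Pow cl B := (classTm t₀ t₁ (Γ := [B]) .zero).interp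

theorem comp_classMap_eq_iff {Z : C} (x y : Z ⟶ B) :
    x ≫ classMap t₀ t₁ = y ≫ classMap t₀ t₁ ↔
      ∀ (W : C) (e : W ⟶ Z) (z : W ⟶ B), Conn t₀ t₁ (e ≫ x) z ↔ Conn t₀ t₁ (e ≫ y) z := by
  have := comp_classTm_eq_iff t₀ t₁ (.zero : Var [B] B) (.zero : Var [B] B) (ctxOne x) (ctxOne y)
  rw [ctxOne_zero, ctxOne_zero] at this
  exact this

theorem classTm_interp {Γ : List C} (b : Var Γ B) :
    (classTm t₀ t₁ b).interp = b.interp ≫ classMap t₀ t₁ := by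
  have := (comp_classTm_eq_iff t₀ t₁ b (.zero : Var [B] B) (𝟙 _) (ctxOne b.interp)).2 fun W e y => by
    rw [ctxOne_zero, Category.id_comp]
  rw [Category.id_comp] at this
  exact this

theorem hom_comp_classMap : t₀.hom ≫ classMap t₀ t₁ = t₁.hom ≫ classMap t₀ t₁ := by
  rw [comp_classMap_eq_iff]
  exact fun W e z => ⟨Conn.step e 1, Conn.step e 0⟩

/-- A morphism coequalised by `t₀` and `t₁` identifies elements with the same class. -/
theorem comp_eq_of_comp_classMap_eq {Z Y : C} {x y : Z ⟶ B}
    (h : x ≫ classMap t₀ t₁ = y ≫ classMap t₀ t₁) (f : B ⟶ Y)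
    (hf : t₀.hom ≫ f = t₁.hom ≫ f) : x ≫ f = y ≫ f := by
  have := ((comp_classMap_eq_iff t₀ t₁ x y).1 h Z (𝟙 Z) y).2
    (by rw [Category.id_comp]; exact Conn.refl _ _ _)
  rw [Category.id_comp] at this
  exact this.comp_eq f hf

theorem coeqFm_factors_iff {Z : C} (z : Z ⟶ Pow cl B) :
    (coeqFm t₀ t₁).interp.Factors z ↔ ∃ (W : C) (e : W ⟶ Z) (b : W ⟶ B), Epi e ∧
      e ≫ z = b ≫ classMap t₀ t₁ := by
  rw [coeqFm]
  refine (Fm.ex_factors_iff _ _).trans ?_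
  refine exists_congr fun W => exists_congr fun e => exists_congr fun b => and_congr_right fun _ => ?_
  rw [Fm.eq_factors_iff, Tm.interp_var, ctxCons_succ, classTm_interp, ← Category.assoc (ctxCons _ _),
    ctxCons_zero]
  exact Eq.congr_left (ctxOne_zero (e ≫ z))

end Connected

end ToposLogic

theorem mainTheorem1 {C : Type u} [Category.{v} C]
    [CartesianMonoidalCategory C] [MonoidalClosed C] [HasFiniteLimits C] [HasCountableColimits C]
    (cl : Subobject.Classifier C) {A B : C} (t₀ t₁ : ToposLogic.Tm cl [A] B) :
    ∃ c : B ⟶ ((ToposLogic.coeqFm t₀ t₁).interp : C),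
      c ≫ (ToposLogic.coeqFm t₀ t₁).interp.arrow =
        (ToposLogic.classTm t₀ t₁ (Γ := [B]) .zero).interp ∧
      ∃ w : t₀.interp ≫ c = t₁.interp ≫ c, Nonempty (IsColimit (Cofork.ofπ c w)) := by
  let Q : Subobject (ToposLogic.Pow cl B) := (ToposLogic.coeqFm t₀ t₁).interp
  have hQ : Q.Factors (ToposLogic.classMap t₀ t₁) :=
    (ToposLogic.coeqFm_factors_iff t₀ t₁ _).2 ⟨B, 𝟙 B, 𝟙 B, inferInstance, rfl⟩
  let c : B ⟶ (Q : C) := Q.factorThru _ hQ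
  have hc : c ≫ Q.arrow = ToposLogic.classMap t₀ t₁ := Q.factorThru_arrow _ hQ
  have w : t₀.hom ≫ c = t₁.hom ≫ c := by
    rw [← cancel_mono Q.arrow, Category.assoc, Category.assoc, hc,
      ToposLogic.hom_comp_classMap]
  have : Epi c := by
    obtain ⟨W, e, b, he, h⟩ := (ToposLogic.coeqFm_factors_iff t₀ t₁ Q.arrow).1 Q.factors_self
    have h' : b ≫ c = e := by
      rw [← cancel_mono Q.arrow, Category.assoc, hc]
      exact h.symm
    have : Epi (b ≫ c) := h' ▸ he
    exact epi_of_epi b c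
  refine ⟨c, hc, w, ⟨Cofork.IsColimit.ofExistsUnique fun s => ?_⟩⟩
  obtain ⟨d, hd⟩ := ToposLogic.exists_desc_of_epi cl c s.π fun X f g h =>
    ToposLogic.comp_eq_of_comp_classMap_eq t₀ t₁
      (by rw [← hc, ← Category.assoc, h, Category.assoc]) s.π s.condition
  exact ⟨d, hd, fun d' hd' => (cancel_epi c).1 (hd'.trans hd.symm)⟩
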